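/- Let $\mathcal H$ be a complex Hilbert space. An operator in $\mathcal H$ is a linear map $E:\mathcal D(E)\to\mathcal H$ defined on a linear subspace $\mathcal D(E)\subseteq\mathcal H$, with range $\mathcal R(E)$ and nullspace $\mathcal N(E)$; products and inverses of operators are taken with their natural domains, and $L(\mathcal H)^+$ denotes the set of bounded, everywhere defined, positive semidefinite operators on $\mathcal H$. A linear subspace $\mathcal S$ of a Hilbert space is semiclosed if there is an inner product $\langle\cdot,\cdot\rangle'$ on $\mathcal S$ such that $(\mathcal S,\langle\cdot,\cdot\rangle')$ is complete and, for some $b>0$, $\langle x,x\rangle\le b\,\langle x,x\rangle'$ for all $x\in\mathcal S$. An operator is semiclosed if its graph is a semiclosed subspace of $\mathcal H\times\mathcal H$. An operator $E$ is a projection if $\mathcal R(E)\subseteq\mathcal D(E)$ and $E^2x=Ex$ for all $x\in\mathcal D(E)$. Let $\mathcal Q_{SC}$ be the set of densely defined semiclosed projections in $\mathcal H$. (1) Let $E\in\mathcal Q_{SC}$ and let $A_1,A_2\in L(\mathcal H)^+$ satisfy $\mathcal R(E)=\mathcal R(A_1)$ and $\mathcal N(E)=\mathcal R(A_2)$. Put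 $\Gamma=(A_1^2+A_2^2)^{1/2}$. Then $\Gamma\in L(\mathcal H)^+$ is injective with $\mathcal R(\Gamma)=\mathcal D(E)$, the operator $\Gamma^{-1}A_1^2$ is everywhere defined and bounded, and $$E=(\Gamma^{-1}A_1^2)^*\,\Gamma^{-1},$$ including equality of domains. (2) Let $E$ be a densely defined operator in $\mathcal H$. Then $E\in\mathcal Q_{SC}$ if and only if there exists an injective $\Gamma\in L(\mathcal H)^+$ with $\mathcal R(\Gamma)=\mathcal D(E)$ such that $\Gamma^{-1}E\Gamma$ is an everywhere defined bounded orthogonal projection $P$, i.e. $P^2=P=P^*$. -/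

import Mathlib

open scoped LinearPMap

namespace SemiclosedProjections

section General

variable {V : Type*} [NormedAddCommGroup V] [InnerProductSpace ℂ V]

/-- A linear subspace `S` of `V` is semiclosed if it carries an inner product `⟨·,·⟩'` for which
`S` is complete and such that `⟨x,x⟩ ≤ b ⟨x,x⟩'` on `S` for some `b > 0`. The completeness is that
of the norm of the new inner product `c`, not of the norm inherited from `V`. -/
def IsSemiclosedSubspace (S : Submodule ℂ V) : Prop :=
  ∃ c : InnerProductSpace.Core ℂ S,
    @CompleteSpace S
      (@InnerProductSpace.Core.toNormedAddCommGroup ℂ S _ _ _ c).toUniformSpace ∧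
    ∃ b : ℝ, 0 < b ∧ ∀ x : S, ‖(x : V)‖ ^ 2 ≤ b * (c.inner x x).re

end General

variable {H : Type*} [NormedAddCommGroup H] [InnerProductSpace ℂ H]

/-- An operator (linear map defined on a subspace) is semiclosed if its graph is a semiclosed
subspace of the Hilbert space `H × H`, which is `WithLp 2 (H × H)`. -/
def IsSemiclosedOperator (C : H →ₗ.[ℂ] H) : Prop :=
  IsSemiclosedSubspace
    (C.graph.map ((WithLp.linearEquiv 2 ℂ (H × H)).symm : (H × H) →ₗ[ℂ] WithLp 2 (H × H)))

/-- The range of an operator. -/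
def opRange (E : H →ₗ.[ℂ] H) : Submodule ℂ H := LinearMap.range E.toFun

/-- The nullspace of an operator, as a subspace of `H`. -/
def opKer (E : H →ₗ.[ℂ] H) : Submodule ℂ H := (LinearMap.ker E.toFun).map E.domain.subtype

/-- `E` is a projection: `R(E) ⊆ D(E)` and `E (E x) = E x` for all `x ∈ D(E)`. -/
def IsProjection (E : H →ₗ.[ℂ] H) : Prop :=
  ∀ x : E.domain, ∃ h : E x ∈ E.domain, E ⟨E x, h⟩ = E x

/-- The class of densely defined semiclosed projections. -/
structure IsQSC (E : H →ₗ.[ℂ] H) : Prop where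
  dense_domain : Dense (E.domain : Set H)
  isProjection : IsProjection E
  isSemiclosed : IsSemiclosedOperator E

/-- The product `g f` of two operators, with its natural domain
`{x ∈ D(f) : f x ∈ D(g)}` (see `mem_graph_opMul`). -/
def opMul (g f : H →ₗ.[ℂ] H) : H →ₗ.[ℂ] H :=
  g.comp (f.domRestrict ((g.domain.comap f.toFun).map f.domain.subtype)) (by
    rintro ⟨x, hx⟩
    obtain ⟨⟨y, hy, hyx⟩, hxf⟩ := Submodule.mem_inf.1 hx
    have h := LinearPMap.domRestrict_apply (f := f) (x := ⟨x, hx⟩) (y := y) hyx.symm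
    exact h.symm ▸ hy)

theorem mem_graph_opMul (g f : H →ₗ.[ℂ] H) (x z : H) :
    (x, z) ∈ (opMul g f).graph ↔ ∃ y, (x, y) ∈ f.graph ∧ (y, z) ∈ g.graph := by
  simp only [LinearPMap.mem_graph_iff]
  constructor
  · rintro ⟨⟨w, hw⟩, rfl, rfl⟩
    have hw' := Submodule.mem_inf.1 hw
    obtain ⟨⟨u, hu, huw⟩, hwf⟩ := hw'
    refine ⟨f u, ⟨u, huw, rfl⟩, ⟨f u, hu⟩, rfl, ?_⟩
    change _ = g ⟨f.domRestrict _ ⟨w, hw⟩, _⟩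
    congr 2
    exact (LinearPMap.domRestrict_apply (y := u) huw.symm).symm
  · rintro ⟨y, ⟨u, rfl, rfl⟩, v, hv, rfl⟩
    have hu : f u ∈ g.domain := hv ▸ v.2
    refine ⟨⟨u, Submodule.mem_inf.2 ⟨⟨u, hu, rfl⟩, u.2⟩⟩, rfl, ?_⟩
    change g ⟨f.domRestrict _ ⟨u, _⟩, _⟩ = _
    congr 1
    ext
    exact (LinearPMap.domRestrict_apply (y := u) rfl).trans hv.symm

/-- A bounded operator, viewed as an operator with domain all of `H`. -/
def ofBounded (T : H →L[ℂ] H) : H →ₗ.[ℂ] H := (T : H →ₗ[ℂ] H).toPMap ⊤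

/-- The inverse of a bounded operator `T`, with domain the range of `T`. It is meaningful only for
injective `T`. -/
noncomputable def opInv (T : H →L[ℂ] H) : H →ₗ.[ℂ] H := (ofBounded T).inverse

/-- The operator `T` is a bounded, everywhere defined, orthogonal projection. -/
def IsOrthogonalProjection [CompleteSpace H] (T : H →ₗ.[ℂ] H) : Prop :=
  ∃ P : H →L[ℂ] H, IsStarProjection P ∧ T = ofBounded P

/-- `Γ(A₁, A₂) = (A₁² + A₂²)^{1/2}`, the positive square root. -/
noncomputable def Gam [CompleteSpace H] (A₁ A₂ : H →L[ℂ] H) : H →L[ℂ] H :=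
  CFC.sqrt (A₁ ^ 2 + A₂ ^ 2)

end SemiclosedProjections

/-!
A projection `E` with range `R` and nullspace `N` has domain `R + N`, and its graph consists of the
pairs `(a + b, a)` with `a ∈ R` and `b ∈ N` (`IsProjection.graph_eq`). Suppose that `R` and `N` are
the ranges of bounded operators `A₁ : K₁ → H` and `A₂ : K₂ → H` on Hilbert spaces, and let `Γ` be
the positive square root of `A₁ A₁* + A₂ A₂*`. Then `‖Γ x‖² = ‖A₁* x‖² + ‖A₂* x‖²`, so `Γ` is
injective when `R + N` is dense, and Douglas' factorization gives bounded `Cᵢ` with `Cᵢ Γ = Aᵢ*`,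
that is `Aᵢ = Γ Cᵢ*`. Substituting in `Γ² = A₁ A₁* + A₂ A₂*` and cancelling `Γ` yields
`Γ = A₁ C₁ + A₂ C₂` (`exists_factorization`). Hence `Γ` has range `R + N`, and since `A₁ C₁ y ∈ R`
and `A₂ C₂ y ∈ N` the operator `E Γ` is the bounded operator `A₁ C₁`
(`IsProjection.exists_factorization`).

Both halves are read off from this identity. If `A₁` is positive, `Γ⁻¹ A₁² = C₁* A₁`, whose adjoint
is `A₁ C₁ = E Γ`. In general `E Γ = A₁ C₁ = Γ C₁* C₁`, so `Γ⁻¹ E Γ` is the self-adjoint operator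
`C₁* C₁`, which is idempotent because `E` is. The operators `Aᵢ` exist for every semiclosed
projection: the graph of `E`, with its complete inner product, maps boundedly onto `R` by
`(x, E x) ↦ E x` and onto `N` by `(x, E x) ↦ x - E x`; they need not be positive operators on `H`.

Conversely, if `Γ⁻¹ E Γ = P` then the graph of `E` is the range of the bounded injection
`y ↦ (Γ y, Γ P y)`, and the inner product of `H` transported along it makes the graph semiclosed.
-/

universe u

namespace SemiclosedProjections

open ContinuousLinearMap

/-! ### Bounded operators and factorization -/

/-- A version of Douglas' lemma: an operator dominated in norm by an operator with dense range
factors through it. -/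
theorem exists_comp_eq_of_norm_le {𝕜 F G K : Type*} [RCLike 𝕜]
    [NormedAddCommGroup F] [NormedSpace 𝕜 F] [NormedAddCommGroup G] [NormedSpace 𝕜 G]
    [NormedAddCommGroup K] [NormedSpace 𝕜 K] [CompleteSpace K]
    (A : F →L[𝕜] K) (B : F →L[𝕜] G) (hB : DenseRange B) (h : ∀ x, ‖A x‖ ≤ ‖B x‖) :
    ∃ C : G →L[𝕜] K, C ∘L B = A := by
  refine ⟨(A : F →ₗ[𝕜] K).extendOfNorm (B : F →ₗ[𝕜] G), ?_⟩
  ext x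
  exact LinearMap.extendOfNorm_eq (f := (A : F →ₗ[𝕜] K)) (e := (B : F →ₗ[𝕜] G)) hB
    ⟨1, fun y => by simpa using h y⟩ x

section Factorization

variable {H K₁ K₂ : Type*}
  [NormedAddCommGroup H] [InnerProductSpace ℂ H] [CompleteSpace H]
  [NormedAddCommGroup K₁] [InnerProductSpace ℂ K₁] [CompleteSpace K₁]
  [NormedAddCommGroup K₂] [InnerProductSpace ℂ K₂] [CompleteSpace K₂]
  {A₁ : K₁ →L[ℂ] H} {A₂ : K₂ →L[ℂ] H} {Γ : H →L[ℂ] H}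

theorem norm_sq_apply_eq_add (hΓ : Γ.IsPositive)
    (hsq : Γ ∘L Γ = A₁ ∘L adjoint A₁ + A₂ ∘L adjoint A₂) (x : H) :
    ‖Γ x‖ ^ 2 = ‖adjoint A₁ x‖ ^ 2 + ‖adjoint A₂ x‖ ^ 2 := by
  have h := congrArg (fun T : H →L[ℂ] H => (inner ℂ (T x) x).re) hsq
  simp only [comp_apply, add_apply, inner_add_left, Complex.add_re] at h
  rw [show inner ℂ (Γ (Γ x)) x = inner ℂ (Γ x) (Γ x) from hΓ.isSymmetric (Γ x) x,
    ← adjoint_inner_right A₁, ← adjoint_inner_right A₂] at h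
  simpa only [← RCLike.re_eq_complex_re, inner_self_eq_norm_sq] using h

/-- A vector killed by `Γ` is killed by both `Aᵢ*`, hence orthogonal to a dense subspace. -/
theorem injective_of_comp_self_eq (hΓ : Γ.IsPositive)
    (hsq : Γ ∘L Γ = A₁ ∘L adjoint A₁ + A₂ ∘L adjoint A₂)
    (hd : Dense ((LinearMap.range (A₁ : K₁ →ₗ[ℂ] H) ⊔ LinearMap.range (A₂ : K₂ →ₗ[ℂ] H) :
      Submodule ℂ H) : Set H)) :
    Function.Injective Γ := by
  refine (injective_iff_map_eq_zero Γ).2 fun x hx => ?_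
  have h := norm_sq_apply_eq_add hΓ hsq x
  rw [hx, norm_zero] at h
  have h1 : adjoint A₁ x = 0 := by
    rw [← norm_eq_zero]; nlinarith [norm_nonneg (adjoint A₁ x), sq_nonneg ‖adjoint A₂ x‖]
  have h2 : adjoint A₂ x = 0 := by
    rw [← norm_eq_zero]; nlinarith [norm_nonneg (adjoint A₂ x), sq_nonneg ‖adjoint A₁ x‖]
  refine hd.eq_zero_of_inner_right (𝕜 := ℂ) fun v hmem => ?_
  obtain ⟨_, ⟨a, rfl⟩, _, ⟨b, rfl⟩, hv⟩ := Submodule.mem_sup.1 hmem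
  rw [← hv, inner_add_left, coe_coe, coe_coe, ← adjoint_inner_right, ← adjoint_inner_right, h1, h2]
  simp

theorem denseRange_of_isPositive_of_injective (hΓ : Γ.IsPositive) (hi : Function.Injective Γ) :
    DenseRange Γ := by
  have h : (LinearMap.range (Γ : H →ₗ[ℂ] H))ᗮ = ⊥ := by
    rw [Γ.orthogonal_range, hΓ.isSelfAdjoint.adjoint_eq]
    exact LinearMap.ker_eq_bot.2 hi
  exact Submodule.dense_iff_topologicalClosure_eq_top.2
    (Submodule.topologicalClosure_eq_top_iff.2 h)

/-- Both `Aᵢ` factor through `Γ`, as `Aᵢ = Γ Cᵢ*`, and then `Γ` itself splits as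
`A₁ C₁ + A₂ C₂`. The last identity exhibits the components of `Γ y` along the ranges
of `A₁` and `A₂`. -/
theorem exists_factorization (hΓ : Γ.IsPositive) (hi : Function.Injective Γ)
    (hsq : Γ ∘L Γ = A₁ ∘L adjoint A₁ + A₂ ∘L adjoint A₂) :
    ∃ (C₁ : H →L[ℂ] K₁) (C₂ : H →L[ℂ] K₂),
      Γ ∘L adjoint C₁ = A₁ ∧ Γ ∘L adjoint C₂ = A₂ ∧ A₁ ∘L C₁ + A₂ ∘L C₂ = Γ := by
  have hdense := denseRange_of_isPositive_of_injective hΓ hi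
  have hn := norm_sq_apply_eq_add hΓ hsq
  obtain ⟨C₁, h1⟩ := exists_comp_eq_of_norm_le (adjoint A₁) Γ hdense fun x =>
    le_of_sq_le_sq (by nlinarith [hn x, sq_nonneg ‖adjoint A₂ x‖]) (norm_nonneg _)
  obtain ⟨C₂, h2⟩ := exists_comp_eq_of_norm_le (adjoint A₂) Γ hdense fun x =>
    le_of_sq_le_sq (by nlinarith [hn x, sq_nonneg ‖adjoint A₁ x‖]) (norm_nonneg _)
  have hsa : adjoint Γ = Γ := hΓ.isSelfAdjoint.adjoint_eq
  have g1 : Γ ∘L adjoint C₁ = A₁ := by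
    have := congrArg adjoint h1
    rwa [adjoint_comp, hsa, adjoint_adjoint] at this
  have g2 : Γ ∘L adjoint C₂ = A₂ := by
    have := congrArg adjoint h2
    rwa [adjoint_comp, hsa, adjoint_adjoint] at this
  refine ⟨C₁, C₂, g1, g2, ?_⟩
  -- cancelling the injective `Γ` in `Γ (C₁* A₁* + C₂* A₂*) = Γ Γ` gives the adjoint identity
  have h : adjoint C₁ ∘L adjoint A₁ + adjoint C₂ ∘L adjoint A₂ = Γ := by
    ext x
    apply hi
    have := DFunLike.congr_fun hsq x
    simp only [comp_apply, add_apply, map_add] at this ⊢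
    rw [this, ← comp_apply Γ, ← comp_apply Γ, g1, g2]
  have := congrArg adjoint h
  rwa [map_add, adjoint_comp, adjoint_comp, adjoint_adjoint, adjoint_adjoint, adjoint_adjoint,
    adjoint_adjoint, hsa] at this

end Factorization

/-! ### Semiclosed subspaces as ranges of bounded operators -/

section Semiclosed

/-- A complex vector space that is complete for an inner product, and mapped to `V` by a linear map
bounded for it, has the range of a bounded operator on a Hilbert space as its image. The vector
space carries no topology of its own, so the one of the inner product is unambiguous. -/
theorem exists_range_eq_of_core {F : Type u} {V : Type*} [AddCommGroup F] [Module ℂ F]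
    [NormedAddCommGroup V] [InnerProductSpace ℂ V] (c : InnerProductSpace.Core ℂ F)
    (hc : @CompleteSpace F
      (@InnerProductSpace.Core.toNormedAddCommGroup ℂ F _ _ _ c).toUniformSpace)
    (f : F →ₗ[ℂ] V) {b : ℝ} (hb : 0 ≤ b) (hf : ∀ x, ‖f x‖ ^ 2 ≤ b * (c.inner x x).re) :
    ∃ (K : Type u) (_ : NormedAddCommGroup K) (_ : InnerProductSpace ℂ K) (_ : CompleteSpace K)
      (J : K →L[ℂ] V), LinearMap.range (J : K →ₗ[ℂ] V) = LinearMap.range f := by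
  let i₁ : NormedAddCommGroup F := @InnerProductSpace.Core.toNormedAddCommGroup ℂ F _ _ _ c
  let i₂ : InnerProductSpace ℂ F := InnerProductSpace.ofCore c.toCore
  refine ⟨F, i₁, i₂, hc, f.mkContinuous (√b) fun x => ?_, rfl⟩
  have h : ‖x‖ ^ 2 = (c.inner x x).re := norm_sq_eq_re_inner (𝕜 := ℂ) x
  refine le_of_sq_le_sq ?_ (by positivity)
  rw [mul_pow, Real.sq_sqrt hb, h]
  exact hf x

/-- A semiclosed subspace is the range of a bounded operator: the inclusion of the subspace,
equipped with its own complete inner product. -/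
theorem IsSemiclosedSubspace.exists_range_eq {V : Type u} [NormedAddCommGroup V]
    [InnerProductSpace ℂ V] {S : Submodule ℂ V} (hS : IsSemiclosedSubspace S) :
    ∃ (K : Type u) (_ : NormedAddCommGroup K) (_ : InnerProductSpace ℂ K) (_ : CompleteSpace K)
      (J : K →L[ℂ] V), LinearMap.range (J : K →ₗ[ℂ] V) = S := by
  obtain ⟨c, hc, b, hb, hle⟩ := hS
  simpa only [S.range_subtype] using exists_range_eq_of_core c hc S.subtype hb.le hle

/-- The inner product of a Hilbert space, transported along a linear equivalence. -/
theorem exists_core_of_linearEquiv {K F : Type*} [NormedAddCommGroup K] [InnerProductSpace ℂ K]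
    [CompleteSpace K] [AddCommGroup F] [Module ℂ F] (e : K ≃ₗ[ℂ] F) :
    ∃ c : InnerProductSpace.Core ℂ F,
      @CompleteSpace F
        (@InnerProductSpace.Core.toNormedAddCommGroup ℂ F _ _ _ c).toUniformSpace ∧
      ∀ x, (c.inner x x).re = ‖e.symm x‖ ^ 2 := by
  let c : InnerProductSpace.Core ℂ F :=
    { inner := fun x y => inner ℂ (e.symm x) (e.symm y)
      conj_inner_symm := fun x y => inner_conj_symm _ _
      re_inner_nonneg := fun x => inner_self_nonneg
      add_left := fun x y z => by rw [map_add, inner_add_left]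
      smul_left := fun x y r => by rw [map_smul, inner_smul_left]
      definite := fun x hx => by simpa using hx }
  refine ⟨c, ?_, fun x => inner_self_eq_norm_sq (𝕜 := ℂ) (e.symm x)⟩
  let i₁ : NormedAddCommGroup F := @InnerProductSpace.Core.toNormedAddCommGroup ℂ F _ _ _ c
  have hiso : Isometry e := by
    refine AddMonoidHomClass.isometry_of_norm e fun x => ?_
    change √(RCLike.re (inner ℂ (e.symm (e x)) (e.symm (e x)))) = ‖x‖
    rw [e.symm_apply_apply, inner_self_eq_norm_sq, Real.sqrt_sq (norm_nonneg _)]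
  exact (hiso.isUniformInducing.completeSpace_congr e.surjective).1 inferInstance

/-- The range of an injective bounded operator on a Hilbert space is semiclosed: it inherits the
inner product of the source. -/
theorem isSemiclosedSubspace_range {V K : Type*} [NormedAddCommGroup V] [InnerProductSpace ℂ V]
    [NormedAddCommGroup K] [InnerProductSpace ℂ K] [CompleteSpace K]
    (J : K →L[ℂ] V) (hJ : Function.Injective J) :
    IsSemiclosedSubspace (LinearMap.range (J : K →ₗ[ℂ] V)) := by
  let e : K ≃ₗ[ℂ] LinearMap.range (J : K →ₗ[ℂ] V) := LinearEquiv.ofInjective (J : K →ₗ[ℂ] V) hJ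
  obtain ⟨c, hc, hn⟩ := exists_core_of_linearEquiv e
  -- `‖J‖ ^ 2 + 1` rather than `‖J‖ ^ 2`, as the constant has to be positive even if `J = 0`
  refine ⟨c, hc, ‖J‖ ^ 2 + 1, by positivity, fun x => ?_⟩
  have hx : (x : V) = J (e.symm x) := congrArg Subtype.val (e.apply_symm_apply x).symm
  have h := pow_le_pow_left₀ (norm_nonneg _) (J.le_opNorm (e.symm x)) 2
  rw [hx, hn]
  nlinarith [sq_nonneg ‖e.symm x‖]

end Semiclosed

/-! ### Graphs of operators and projections -/

section Operators

variable {H : Type u} [NormedAddCommGroup H] [InnerProductSpace ℂ H]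

theorem mem_graph_ofBounded (T : H →L[ℂ] H) (x z : H) :
    (x, z) ∈ (ofBounded T).graph ↔ T x = z := by
  rw [LinearPMap.mem_graph_iff]
  constructor
  · rintro ⟨y, rfl, rfl⟩
    rfl
  · rintro rfl
    exact ⟨⟨x, Submodule.mem_top⟩, rfl, rfl⟩

theorem mem_graph_opInv {Γ : H →L[ℂ] H} (hΓ : Function.Injective Γ) (x z : H) :
    (x, z) ∈ (opInv Γ).graph ↔ Γ z = x := by
  have hk : LinearMap.ker (ofBounded Γ).toFun = ⊥ :=
    LinearMap.ker_eq_bot.2 fun a b hab => Subtype.ext (hΓ hab)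
  rw [opInv, LinearPMap.inverse_graph hk, ← mem_graph_ofBounded]
  constructor
  · rintro ⟨⟨a, b⟩, hab, h⟩
    obtain ⟨rfl, rfl⟩ := Prod.ext_iff.1 h
    exact hab
  · exact fun h => ⟨(z, x), h, rfl⟩

theorem ofBounded_ext {T : H →ₗ.[ℂ] H} {S : H →L[ℂ] H}
    (h : ∀ x z, (x, z) ∈ T.graph ↔ S x = z) : T = ofBounded S :=
  LinearPMap.eq_of_eq_graph (Submodule.ext fun ⟨x, z⟩ => by rw [h, mem_graph_ofBounded])

theorem adjoint_ofBounded [CompleteSpace H] (T : H →L[ℂ] H) :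
    (ofBounded T)† = ofBounded (adjoint T) :=
  toPMap_adjoint_eq_adjoint_toPMap_of_dense T (by simp)

theorem mem_opRange {E : H →ₗ.[ℂ] H} {z : H} : z ∈ opRange E ↔ ∃ x, (x, z) ∈ E.graph := by
  simp [opRange, LinearPMap.mem_graph_iff]

theorem mem_opKer {E : H →ₗ.[ℂ] H} {x : H} : x ∈ opKer E ↔ (x, 0) ∈ E.graph := by
  simp [opKer, LinearPMap.mem_graph_iff, and_comm]

theorem isProjection_iff {E : H →ₗ.[ℂ] H} :
    IsProjection E ↔ ∀ x z, (x, z) ∈ E.graph → (z, z) ∈ E.graph := by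
  simp only [IsProjection, LinearPMap.mem_graph_iff]
  constructor
  · rintro h _ _ ⟨x, rfl, rfl⟩
    obtain ⟨hx, h⟩ := h x
    exact ⟨_, rfl, h⟩
  · intro h x
    obtain ⟨y, hy, hE⟩ := h x (E x) ⟨x, rfl, rfl⟩
    have hm : E x ∈ E.domain := hy ▸ y.2
    refine ⟨hm, ?_⟩
    exact (congrArg E (Subtype.ext hy.symm)).trans hE

theorem IsProjection.graph_eq {E : H →ₗ.[ℂ] H} (hE : IsProjection E) (x z : H) :
    (x, z) ∈ E.graph ↔ z ∈ opRange E ∧ x - z ∈ opKer E := by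
  rw [mem_opRange, mem_opKer]
  have hp := isProjection_iff.1 hE
  constructor
  · exact fun h => ⟨⟨x, h⟩, by simpa using E.graph.sub_mem h (hp _ _ h)⟩
  · rintro ⟨⟨y, hy⟩, h⟩
    simpa using E.graph.add_mem h (hp _ _ hy)

theorem IsProjection.opRange_sup_opKer {E : H →ₗ.[ℂ] H} (hE : IsProjection E) :
    opRange E ⊔ opKer E = E.domain := by
  ext x
  rw [LinearPMap.mem_domain_iff, Submodule.mem_sup]
  constructor
  · rintro ⟨a, ha, b, hb, rfl⟩
    exact ⟨a, (hE.graph_eq _ _).2 ⟨ha, by simpa using hb⟩⟩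
  · rintro ⟨z, hz⟩
    obtain ⟨h1, h2⟩ := (hE.graph_eq _ _).1 hz
    exact ⟨z, h1, x - z, h2, by simp⟩

/-- If `E Γ` is the bounded operator `S`, then `E = S Γ⁻¹` as soon as the domain of `E` is the
range of `Γ`. -/
theorem mem_graph_iff_of_range_eq_domain {E : H →ₗ.[ℂ] H} {Γ S : H →L[ℂ] H}
    (hr : LinearMap.range (Γ : H →ₗ[ℂ] H) = E.domain) (hS : ∀ y, (Γ y, S y) ∈ E.graph) (x z : H) :
    (x, z) ∈ E.graph ↔ ∃ y, Γ y = x ∧ S y = z := by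
  constructor
  · intro h
    have hx : x ∈ E.domain := LinearPMap.mem_domain_of_mem_graph h
    rw [← hr] at hx
    obtain ⟨y, rfl⟩ := hx
    exact ⟨y, rfl, E.mem_graph_snd_inj (hS y) h rfl⟩
  · rintro ⟨y, rfl, rfl⟩
    exact hS y

/-- The range and nullspace of a semiclosed projection are ranges of bounded operators on a
common Hilbert space, the graph of `E` with its complete inner product, namely of
`(x, E x) ↦ E x` and of `(x, E x) ↦ x - E x`. -/
theorem exists_range_eq_opRange_opKer {E : H →ₗ.[ℂ] H} (hE : IsProjection E)
    (hs : IsSemiclosedOperator E) :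
    ∃ (K : Type u) (_ : NormedAddCommGroup K) (_ : InnerProductSpace ℂ K) (_ : CompleteSpace K)
      (A₁ A₂ : K →L[ℂ] H), opRange E = LinearMap.range (A₁ : K →ₗ[ℂ] H) ∧
        opKer E = LinearMap.range (A₂ : K →ₗ[ℂ] H) := by
  obtain ⟨K, iK, iK', iK'', J, hJ⟩ := hs.exists_range_eq
  let L : K →L[ℂ] H × H := (WithLp.prodContinuousLinearEquiv 2 ℂ H H : _ →L[ℂ] H × H) ∘L J
  have hL : ∀ x z, (x, z) ∈ E.graph ↔ ∃ k, L k = (x, z) := by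
    intro x z
    have : (x, z) ∈ E.graph ↔ WithLp.toLp 2 (x, z) ∈ LinearMap.range (J : K →ₗ[ℂ] _) := by
      rw [hJ]
      constructor
      · exact fun h => ⟨(x, z), h, rfl⟩
      · rintro ⟨p, hp, h⟩
        have : p = (x, z) := (WithLp.linearEquiv 2 ℂ (H × H)).symm.injective h
        exact this ▸ hp
    rw [this]
    constructor
    · rintro ⟨k, hk⟩
      exact ⟨k, congrArg WithLp.ofLp hk⟩
    · rintro ⟨k, hk⟩
      exact ⟨k, congrArg (WithLp.toLp 2) hk⟩
  refine ⟨K, iK, iK', iK'', ContinuousLinearMap.snd ℂ H H ∘L L,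
    (ContinuousLinearMap.fst ℂ H H - ContinuousLinearMap.snd ℂ H H) ∘L L, ?_, ?_⟩
  · ext z
    rw [mem_opRange]
    constructor
    · rintro ⟨x, hx⟩
      obtain ⟨k, hk⟩ := (hL _ _).1 hx
      exact ⟨k, congrArg Prod.snd hk⟩
    · rintro ⟨k, rfl⟩
      exact ⟨(L k).1, (hL _ _).2 ⟨k, rfl⟩⟩
  · ext x
    constructor
    · intro hx
      obtain ⟨k, hk⟩ := (hL _ _).1 (mem_opKer.1 hx)
      refine ⟨k, ?_⟩
      change (L k).1 - (L k).2 = x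
      rw [hk, sub_zero]
    · rintro ⟨k, rfl⟩
      exact ((hE.graph_eq _ _).1 ((hL (L k).1 (L k).2).2 ⟨k, rfl⟩)).2

/-- The factorization attached to a projection: `Γ` has range the domain of `E`, and
`E Γ = A₁ C₁` where `A₁ = Γ C₁*`. -/
theorem IsProjection.exists_factorization [CompleteSpace H] {K₁ K₂ : Type*}
    [NormedAddCommGroup K₁] [InnerProductSpace ℂ K₁] [CompleteSpace K₁]
    [NormedAddCommGroup K₂] [InnerProductSpace ℂ K₂] [CompleteSpace K₂]
    {E : H →ₗ.[ℂ] H} (hE : IsProjection E) (hd : Dense (E.domain : Set H))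
    {A₁ : K₁ →L[ℂ] H} {A₂ : K₂ →L[ℂ] H} {Γ : H →L[ℂ] H}
    (h1 : opRange E = LinearMap.range (A₁ : K₁ →ₗ[ℂ] H))
    (h2 : opKer E = LinearMap.range (A₂ : K₂ →ₗ[ℂ] H)) (hΓ : Γ.IsPositive)
    (hsq : Γ ∘L Γ = A₁ ∘L adjoint A₁ + A₂ ∘L adjoint A₂) :
    Function.Injective Γ ∧ LinearMap.range (Γ : H →ₗ[ℂ] H) = E.domain ∧
      ∃ C : H →L[ℂ] K₁, Γ ∘L adjoint C = A₁ ∧ ∀ y, (Γ y, (A₁ ∘L C) y) ∈ E.graph := by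
  have hdom := hE.opRange_sup_opKer
  have hi : Function.Injective Γ :=
    injective_of_comp_self_eq hΓ hsq (by rwa [← h1, ← h2, hdom])
  obtain ⟨C₁, C₂, g1, g2, hsum⟩ := SemiclosedProjections.exists_factorization hΓ hi hsq
  have hgr : ∀ y, (Γ y, (A₁ ∘L C₁) y) ∈ E.graph := fun y => by
    rw [hE.graph_eq, h1, h2]
    refine ⟨⟨C₁ y, rfl⟩, C₂ y, ?_⟩
    rw [← hsum]
    simp
  refine ⟨hi, le_antisymm ?_ ?_, C₁, g1, hgr⟩
  · rintro _ ⟨y, rfl⟩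
    exact LinearPMap.mem_domain_of_mem_graph (hgr y)
  · rw [← hdom, h1, h2, sup_le_iff]
    constructor
    · rintro _ ⟨k, rfl⟩
      exact ⟨adjoint C₁ k, DFunLike.congr_fun g1 k⟩
    · rintro _ ⟨k, rfl⟩
      exact ⟨adjoint C₂ k, DFunLike.congr_fun g2 k⟩

theorem isPositive_sqrt [CompleteSpace H] (S : H →L[ℂ] H) : (CFC.sqrt S).IsPositive :=
  (nonneg_iff_isPositive _).1 (CFC.sqrt_nonneg S)

theorem sqrt_comp_sqrt [CompleteSpace H] {S : H →L[ℂ] H} (hS : S.IsPositive) :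
    CFC.sqrt S ∘L CFC.sqrt S = S :=
  CFC.sqrt_mul_sqrt_self S ((nonneg_iff_isPositive _).2 hS)

/-- The compression `Γ⁻¹ E Γ` is the bounded operator `P` exactly when `Γ P = E Γ`. -/
theorem opMul_opInv_opMul_eq_ofBounded_iff {E : H →ₗ.[ℂ] H} {Γ P : H →L[ℂ] H}
    (hi : Function.Injective Γ) :
    opMul (opInv Γ) (opMul E (ofBounded Γ)) = ofBounded P ↔
      ∀ y, (Γ y, (Γ ∘L P) y) ∈ E.graph := by
  have hg : ∀ x z, (x, z) ∈ (opMul (opInv Γ) (opMul E (ofBounded Γ))).graph ↔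
      (Γ x, Γ z) ∈ E.graph := by
    simp only [mem_graph_opMul, mem_graph_ofBounded, mem_graph_opInv hi, exists_eq_left',
      exists_eq_right', implies_true]
  constructor
  · intro h y
    rw [comp_apply, ← hg, h, mem_graph_ofBounded]
  · intro h
    refine ofBounded_ext fun x z => ?_
    rw [hg]
    constructor
    · exact fun hz => hi (E.mem_graph_snd_inj (h x) hz rfl)
    · rintro rfl
      exact h x

/-- A semiclosed projection is similar to an orthogonal projection: if `A₁ = Γ C*` and
`E Γ = A₁ C` then `Γ⁻¹ E Γ = C* C`. -/
theorem IsQSC.exists_isOrthogonalProjection [CompleteSpace H] {E : H →ₗ.[ℂ] H} (hE : IsQSC E) :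
    ∃ Γ : H →L[ℂ] H, Γ.IsPositive ∧ Function.Injective Γ ∧
      LinearMap.range (Γ : H →ₗ[ℂ] H) = E.domain ∧
      IsOrthogonalProjection (opMul (opInv Γ) (opMul E (ofBounded Γ))) := by
  obtain ⟨K, iK, iK', iK'', A₁, A₂, h1, h2⟩ :=
    exists_range_eq_opRange_opKer hE.isProjection hE.isSemiclosed
  have hpos : (A₁ ∘L adjoint A₁ + A₂ ∘L adjoint A₂).IsPositive :=
    (isPositive_self_comp_adjoint A₁).add (isPositive_self_comp_adjoint A₂)
  obtain ⟨hi, hr, C, g, hgr⟩ := hE.isProjection.exists_factorization hE.dense_domain h1 h2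
    (isPositive_sqrt _) (sqrt_comp_sqrt hpos)
  set Γ := CFC.sqrt (A₁ ∘L adjoint A₁ + A₂ ∘L adjoint A₂)
  have hP : ∀ y, (Γ y, (Γ ∘L (adjoint C ∘L C)) y) ∈ E.graph := by
    rwa [← comp_assoc, g]
  refine ⟨Γ, isPositive_sqrt _, hi, hr, adjoint C ∘L C, ⟨?_, ?_⟩,
    (opMul_opInv_opMul_eq_ofBounded_iff hi).2 hP⟩
  · -- `Γ P P y = E (Γ P y) = E (E (Γ y)) = E (Γ y) = Γ P y`
    ext y
    exact hi (E.mem_graph_snd_inj (hP _) (isProjection_iff.1 hE.isProjection _ _ (hP y)) rfl)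
  · exact (isPositive_adjoint_comp_self C).isSelfAdjoint

/-- An operator similar to a bounded idempotent `P` through `Γ` is a semiclosed projection: its
graph is the range of the bounded injection `y ↦ (Γ y, Γ P y)`. -/
theorem isQSC_of_similar [CompleteSpace H] {E : H →ₗ.[ℂ] H} {Γ P : H →L[ℂ] H}
    (hd : Dense (E.domain : Set H)) (hi : Function.Injective Γ)
    (hr : LinearMap.range (Γ : H →ₗ[ℂ] H) = E.domain) (hP : IsIdempotentElem P)
    (hg : ∀ y, (Γ y, (Γ ∘L P) y) ∈ E.graph) : IsQSC E := by
  have hgr := mem_graph_iff_of_range_eq_domain hr hg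
  refine ⟨hd, isProjection_iff.2 fun x z h => ?_, ?_⟩
  · obtain ⟨y, rfl, rfl⟩ := (hgr _ _).1 h
    have := hg (P y)
    rwa [comp_apply, show P (P y) = P y from DFunLike.congr_fun hP.eq y] at this
  · let J : H →L[ℂ] WithLp 2 (H × H) :=
      ((WithLp.prodContinuousLinearEquiv 2 ℂ H H).symm : H × H →L[ℂ] _) ∘L Γ.prod (Γ ∘L P)
    have hJ : Function.Injective J := fun a b hab =>
      hi (congrArg (fun w : WithLp 2 (H × H) => w.ofLp.1) hab)
    have hrange : E.graph.map ((WithLp.linearEquiv 2 ℂ (H × H)).symm :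
        (H × H) →ₗ[ℂ] WithLp 2 (H × H)) = LinearMap.range (J : H →ₗ[ℂ] WithLp 2 (H × H)) := by
      ext w
      constructor
      · rintro ⟨⟨x, z⟩, hxz, rfl⟩
        obtain ⟨y, rfl, rfl⟩ := (hgr _ _).1 hxz
        exact ⟨y, rfl⟩
      · rintro ⟨y, rfl⟩
        exact ⟨(Γ y, (Γ ∘L P) y), hg y, rfl⟩
    rw [IsSemiclosedOperator, hrange]
    exact isSemiclosedSubspace_range J hJ

end Operators

end SemiclosedProjections

theorem mainTheorem2 {H : Type*} [NormedAddCommGroup H] [InnerProductSpace ℂ H] [CompleteSpace H]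
    (E : H →ₗ.[ℂ] H) :
    (∀ A₁ A₂ : H →L[ℂ] H, SemiclosedProjections.IsQSC E → A₁.IsPositive → A₂.IsPositive →
      SemiclosedProjections.opRange E = LinearMap.range (A₁ : H →ₗ[ℂ] H) →
      SemiclosedProjections.opKer E = LinearMap.range (A₂ : H →ₗ[ℂ] H) →
      ((SemiclosedProjections.Gam A₁ A₂).IsPositive ∧
        Function.Injective (SemiclosedProjections.Gam A₁ A₂) ∧
        LinearMap.range (SemiclosedProjections.Gam A₁ A₂ : H →ₗ[ℂ] H) = E.domain ∧
        (∃ T : H →L[ℂ] H,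
          SemiclosedProjections.opMul
              (SemiclosedProjections.opInv (SemiclosedProjections.Gam A₁ A₂))
              (SemiclosedProjections.ofBounded (A₁ ^ 2)) =
            SemiclosedProjections.ofBounded T) ∧
        E = SemiclosedProjections.opMul
              (SemiclosedProjections.opMul
                (SemiclosedProjections.opInv (SemiclosedProjections.Gam A₁ A₂))
                (SemiclosedProjections.ofBounded (A₁ ^ 2)))†
              (SemiclosedProjections.opInv (SemiclosedProjections.Gam A₁ A₂)))) ∧
    (Dense (E.domain : Set H) →
      (SemiclosedProjections.IsQSC E ↔
        ∃ Γ : H →L[ℂ] H, Γ.IsPositive ∧ Function.Injective Γ ∧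
          LinearMap.range (Γ : H →ₗ[ℂ] H) = E.domain ∧
          SemiclosedProjections.IsOrthogonalProjection
            (SemiclosedProjections.opMul (SemiclosedProjections.opInv Γ)
              (SemiclosedProjections.opMul E (SemiclosedProjections.ofBounded Γ))))) := by
  open SemiclosedProjections ContinuousLinearMap in
  refine ⟨fun A₁ A₂ hE hA₁ hA₂ h1 h2 => ?_,
    fun hd => ⟨fun hE => hE.exists_isOrthogonalProjection, ?_⟩⟩
  · have e1 : adjoint A₁ = A₁ := hA₁.isSelfAdjoint.adjoint_eq
    have e2 : adjoint A₂ = A₂ := hA₂.isSelfAdjoint.adjoint_eq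
    have hsum : A₁ ^ 2 + A₂ ^ 2 = A₁ ∘L adjoint A₁ + A₂ ∘L adjoint A₂ := by
      rw [e1, e2, pow_two, pow_two]
      rfl
    have hpos : (A₁ ^ 2 + A₂ ^ 2).IsPositive := hsum ▸
      (isPositive_self_comp_adjoint A₁).add (isPositive_self_comp_adjoint A₂)
    have hΓ : (Gam A₁ A₂).IsPositive := isPositive_sqrt _
    obtain ⟨hi, hr, C, g, hgr⟩ := hE.isProjection.exists_factorization hE.dense_domain h1 h2
      hΓ ((sqrt_comp_sqrt hpos).trans hsum)
    -- `Γ⁻¹ A₁² = C* A₁`, because `A₁ = Γ C*`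
    have hT : opMul (opInv (Gam A₁ A₂)) (ofBounded (A₁ ^ 2)) = ofBounded (adjoint C ∘L A₁) := by
      refine ofBounded_ext fun x z => ?_
      have hx : (A₁ ^ 2) x = Gam A₁ A₂ ((adjoint C ∘L A₁) x) := by
        rw [comp_apply, ← comp_apply (Gam A₁ A₂), g, pow_two]
        rfl
      simp only [mem_graph_opMul, mem_graph_ofBounded, mem_graph_opInv hi, exists_eq_left', hx]
      exact hi.eq_iff.trans eq_comm
    refine ⟨hΓ, hi, hr, ⟨_, hT⟩, LinearPMap.eq_of_eq_graph (Submodule.ext fun ⟨x, z⟩ => ?_)⟩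
    rw [hT, adjoint_ofBounded, adjoint_comp, adjoint_adjoint, e1, mem_graph_opMul,
      mem_graph_iff_of_range_eq_domain hr hgr]
    simp only [mem_graph_opInv hi, mem_graph_ofBounded]
  · rintro ⟨Γ, -, hi, hr, P, hP, h⟩
    exact isQSC_of_similar hd hi hr hP.isIdempotentElem
      ((opMul_opInv_opMul_eq_ofBounded_iff hi).1 h)
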